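/- There is an absolute constant $n_0$ such that the following holds for every integer $n\ge n_0$. Let $T$ be a tree with $n$ vertices and maximum degree $\Delta$, suppose that $T$ has at least $n/(\log n)^3$ leaves, and let $v$ be an arbitrary vertex of $T$. Let $G$ be an $n$-vertex graph with minimum degree $\delta(G)\ge n-\frac{n}{\Delta(\log n)^5}$ and let $x\in V(G)$. Let $p\in[0,1]$ satisfy $p\ge \frac{\Delta(\log n)^5}{n}$, and let $G_p$ denote the random subgraph of $G$ obtained by keeping each edge of $G$ with probability $p$, independently of the other edges. Then with probability at least $1-n^{-4}$, there is an embedding of $T$ into $G_p$ (an injective map $V(T)\to V(G)$ that sends edges of $T$ to edges of $G_p$) that maps $v$ to $x$. -/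

import Mathlib

open MeasureTheory ProbabilityTheory

namespace SimpleGraph

/-- The law of the `p`-random subgraph `G_p` of `G`: the spanning subgraph of `G` obtained by
keeping each edge of `G` with probability `p`, independently of the other edges. -/
noncomputable def randomSubgraph {V : Type*} (G : SimpleGraph V) (p : unitInterval) :
    Measure (SimpleGraph V) :=
  (setBernoulli G.edgeSet p).map fromEdgeSet

instance {V : Type*} (G : SimpleGraph V) (p : unitInterval) :
    IsProbabilityMeasure (randomSubgraph G p) :=
  Measure.isProbabilityMeasure_map measurable_fromEdgeSet.aemeasurable

/-- The event that there is an embedding of `T` (an injective graph homomorphism, not necessarily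
an induced copy) into the random graph which maps the vertex `v` to the vertex `x`. -/
def rootedEmbeddingEvent {U V : Type*} (T : SimpleGraph U) (v : U) (x : V) :
    Set (SimpleGraph V) :=
  {H | ∃ φ : T.Copy H, φ v = x}

end SimpleGraph

/-!
The tree is embedded in two rounds. Choosing `q` with `(1 - q) ^ 2 = 1 - p`, the random graph `G_p`
is the union of two independent copies of `G_q` (`setBernoulli_real_le_of_union`); the first
receives the tree without its leaves, the second attaches the leaves (the root `v` never counts as
a leaf).

Root the tree at `v`, which is sent to `x`. In the first round the vertices are expanded one after
the other: expanding `w` reveals the random edges at the image of `w` only and places all children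
of `w` that are not leaves on unused neighbours. What remains to be done concerns edges that avoid
this image, so it is independent of what was revealed, and the failure probabilities simply add up
(`LeafyTree.setBernoulli_real_not_extends_le`). In the second round the leaves have to be matched
to the unused vertices, for which Hall's condition is checked (`LeafyTree.exists_leaf_matching`).

Both rounds rest on one union bound, `setBernoulli_real_nonExpanding_le`: for fixed disjoint `P`
and `Q`, it is unlikely that some nonempty `W ⊆ P` has at most `k * #W` neighbours in `Q`, apart
from the case where these leave fewer than `r` vertices of `Q`. It needs `q * (r - γ)` to exceed
`(k + 11) * log n`, where `γ = n / (Δ (log n) ^ 5)` bounds the number of non-neighbours of a vertex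
of `G`. As there are about `Δ (log n) ^ 2 γ` leaves and `q * γ ≥ 1 / 2`, this holds with room to
spare in the three cases that occur: expanding one vertex, from parents to unused vertices
(`k = Δ`), and from unused vertices to parents (`k = 1`).
-/

/-! ### Binomial random subsets -/

namespace ProbabilityTheory

variable {ι : Type*}

/-- Combining two independent binomial random subsets of `u` coordinate by coordinate gives a
binomial random subset, provided that this is so for each single coordinate. -/
theorem map_prod_setBernoulli [Finite ι] (u : Set ι) (a b c : unitInterval)
    (h : ι → Prop → Prop → Prop)
    (hh : ∀ i, ((unitInterval.toNNReal a • Measure.dirac (i ∈ u) +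
        unitInterval.toNNReal (unitInterval.symm a) • Measure.dirac False).prod
        (unitInterval.toNNReal b • Measure.dirac (i ∈ u) +
        unitInterval.toNNReal (unitInterval.symm b) • Measure.dirac False)).map
          (fun x : Prop × Prop => h i x.1 x.2) =
        unitInterval.toNNReal c • Measure.dirac (i ∈ u) +
        unitInterval.toNNReal (unitInterval.symm c) • Measure.dirac False) :
    ((setBernoulli u a).prod (setBernoulli u b)).map
      (fun x : Set ι × Set ι => {i | h i (i ∈ x.1) (i ∈ x.2)}) = setBernoulli u c := by
  cases nonempty_fintype ι
  rw [setBernoulli_eq_map, setBernoulli_eq_map, setBernoulli_eq_map,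
    Measure.infinitePi_eq_pi, Measure.infinitePi_eq_pi, Measure.infinitePi_eq_pi]
  have hm : Measurable (fun p : ι → Prop => {i | p i}) :=
    MeasurableEquiv.setOfPred.measurable
  rw [Measure.map_prod_map _ _ hm hm, Measure.map_map .of_discrete (hm.prodMap hm),
    ← (measurePreserving_arrowProdEquivProdArrow Prop Prop ι _ _).map_eq,
    Measure.map_map .of_discrete (MeasurableEquiv.measurable _)]
  simp_rw [← hh]
  rw [← Measure.pi_map_pi (fun i => Measurable.of_discrete.aemeasurable),
    Measure.map_map hm .of_discrete]
  rfl

/-- Resampling a binomial random set outside `E` does not change its law. -/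
theorem map_prod_setBernoulli_ite [Finite ι] (u E : Set ι) (q : unitInterval) :
    ((setBernoulli u q).prod (setBernoulli u q)).map
      (fun x : Set ι × Set ι => (x.1 ∩ E) ∪ (x.2 \ E)) = setBernoulli u q := by
  classical
  have e : (fun x : Set ι × Set ι => (x.1 ∩ E) ∪ (x.2 \ E)) =
      fun x => {i | if i ∈ E then i ∈ x.1 else i ∈ x.2} := by
    ext x i
    by_cases hi : i ∈ E <;> simp [hi]
  rw [e]
  refine map_prod_setBernoulli u q q q (fun i x y => if i ∈ E then x else y) ?_
  · intro i
    by_cases hi : i ∈ E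
    · simp only [hi, if_true]
      exact (measurePreserving_fst (μ := _) (ν := _)).map_eq
    · simp only [hi, if_false]
      exact (measurePreserving_snd (μ := _) (ν := _)).map_eq

theorem map_prod_setBernoulli_union [Finite ι] (u : Set ι) (q p : unitInterval)
    (hqp : (1 - (q : ℝ)) ^ 2 = 1 - p) :
    ((setBernoulli u q).prod (setBernoulli u q)).map
      (fun x : Set ι × Set ι => x.1 ∪ x.2) = setBernoulli u p := by
  refine map_prod_setBernoulli u q q p (fun i x y => x ∨ y) ?_
  · intro i
    have h1 : unitInterval.toNNReal (unitInterval.symm p) =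
        unitInterval.toNNReal (unitInterval.symm q) *
          unitInterval.toNNReal (unitInterval.symm q) := by
      ext; simp; linarith
    have h2 : unitInterval.toNNReal p = unitInterval.toNNReal q * unitInterval.toNNReal q +
        unitInterval.toNNReal q * unitInterval.toNNReal (unitInterval.symm q) +
        unitInterval.toNNReal (unitInterval.symm q) * unitInterval.toNNReal q := by
      ext; simp; linarith
    rw [h1, h2]
    ext s hs
    rw [Measure.map_apply .of_discrete hs]
    simp [Measure.prod_add, Measure.add_prod, Measure.prod_smul_left, Measure.prod_smul_right,
      Measure.dirac_prod_dirac]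
    have hor (x y : Prop) : ((fun x : Prop × Prop => x.1 ∨ x.2) ⁻¹' s).indicator
        (1 : Prop × Prop → ENNReal) (x, y) = s.indicator 1 (x ∨ y) := rfl
    simp only [hor, or_self, or_false, false_or, add_smul, mul_smul]
    abel

/-- Fubini in the form of a union bound: the second coordinate has to avoid a set that depends on
the first one. -/
theorem measureReal_prod_le {α β : Type*} [MeasurableSpace α] [MeasurableSpace β]
    [DiscreteMeasurableSpace α] [DiscreteMeasurableSpace β] [Finite α] [Finite β]
    (μ : Measure α) (ν : Measure β) [IsProbabilityMeasure μ] [IsProbabilityMeasure ν]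
    (B₁ : Set α) (B₂ : α → Set β) {ε₁ ε₂ : ℝ} (h₁ : μ.real B₁ ≤ ε₁) (hε : 0 ≤ ε₂)
    (h₂ : ∀ a, ν.real (B₂ a) ≤ ε₂) :
    (μ.prod ν).real {x | x.1 ∈ B₁ ∨ x.2 ∈ B₂ x.1} ≤ ε₁ + ε₂ := by
  have e : {x : α × β | x.1 ∈ B₁ ∨ x.2 ∈ B₂ x.1} =
    Prod.fst ⁻¹' B₁ ∪ {x | x.2 ∈ B₂ x.1} := rfl
  rw [e]
  refine (measureReal_union_le _ _).trans (add_le_add ?_ ?_)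
  · rw [measureReal_def, (measurePreserving_fst (μ := μ) (ν := ν)).measure_preimage
      (MeasurableSet.of_discrete (s := B₁)).nullMeasurableSet]
    exact h₁
  · refine ENNReal.toReal_le_of_le_ofReal hε ?_
    rw [Measure.prod_apply .of_discrete]
    calc _ ≤ ∫⁻ a, ENNReal.ofReal ε₂ ∂μ := by
          refine lintegral_mono fun a => ?_
          exact (ENNReal.le_ofReal_iff_toReal_le (measure_ne_top _ _) hε).2 (h₂ a)
      _ = _ := by simp

/-- To bound the probability of `S`, reveal the random set inside `E` first: either this already
lands in `B₁`, or the part outside `E`, which is independent of it, lands in a set `B₂ A₁`. -/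
theorem setBernoulli_real_le_of_reveal [Finite ι] (u E : Set ι) (q : unitInterval)
    (S B₁ : Set (Set ι)) (B₂ : Set ι → Set (Set ι)) {ε₁ ε₂ : ℝ}
    (h : ∀ A₁ A₂, (A₁ ∩ E) ∪ (A₂ \ E) ∈ S → A₁ ∈ B₁ ∨ A₂ ∈ B₂ A₁)
    (h₁ : (setBernoulli u q).real B₁ ≤ ε₁) (hε : 0 ≤ ε₂)
    (h₂ : ∀ A, (setBernoulli u q).real (B₂ A) ≤ ε₂) :
    (setBernoulli u q).real S ≤ ε₁ + ε₂ := by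
  rw [← map_prod_setBernoulli_ite u E q, map_measureReal_apply .of_discrete .of_discrete]
  refine le_trans (measureReal_mono ?_) (measureReal_prod_le _ _ B₁ B₂ h₁ hε h₂)
  rintro ⟨A₁, A₂⟩ hA
  exact h A₁ A₂ hA

/-- Two-round exposure: a random set with parameter `p` is the union of two independent ones with
parameter `q`, and the bad event of the second round may depend on the first. -/
theorem setBernoulli_real_le_of_union [Finite ι] (u : Set ι) (q p : unitInterval)
    (hqp : (1 - (q : ℝ)) ^ 2 = 1 - p)
    (S B₁ : Set (Set ι)) (B₂ : Set ι → Set (Set ι)) {ε₁ ε₂ : ℝ}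
    (h : ∀ A₁ A₂, A₁ ∪ A₂ ∈ S → A₁ ∈ B₁ ∨ A₂ ∈ B₂ A₁)
    (h₁ : (setBernoulli u q).real B₁ ≤ ε₁) (hε : 0 ≤ ε₂)
    (h₂ : ∀ A, (setBernoulli u q).real (B₂ A) ≤ ε₂) :
    (setBernoulli u p).real S ≤ ε₁ + ε₂ := by
  rw [← map_prod_setBernoulli_union u q p hqp, map_measureReal_apply .of_discrete .of_discrete]
  refine le_trans (measureReal_mono ?_) (measureReal_prod_le _ _ B₁ B₂ h₁ hε h₂)
  rintro ⟨A₁, A₂⟩ hA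
  exact h A₁ A₂ hA

theorem setBernoulli_real_disjoint [Finite ι] (u : Set ι) (q : unitInterval) (F : Finset ι)
    (hF : (F : Set ι) ⊆ u) :
    (setBernoulli u q).real {A | ∀ i ∈ F, i ∉ A} = (1 - (q : ℝ)) ^ F.card := by
  have e : (fun p : ι → Prop => {i | p i}) ⁻¹' {A | ∀ i ∈ F, i ∉ A} =
      (F : Set ι).pi (fun _ => {False}) := by
    ext f; simp [Set.mem_pi]
  rw [measureReal_def, setBernoulli_apply', e, Measure.infinitePi_pi _ (fun _ _ => .of_discrete),
    Finset.prod_congr rfl (g := fun _ => ENNReal.ofReal (1 - (q : ℝ))), Finset.prod_const,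
    ENNReal.toReal_pow, ENNReal.toReal_ofReal (by linarith [q.2.2])]
  intro i hi
  have : i ∈ u := hF hi
  simp [this]
  rw [ENNReal.ofReal]
  congr 1
  ext
  simp [Real.coe_toNNReal _ (sub_nonneg.2 q.2.2)]

end ProbabilityTheory

/-! ### Expansion of random graphs -/

namespace SimpleGraph

variable {V : Type*} [Fintype V]

/-- A set `W` is joined to a disjoint set `B` by no random edge with probability at most
`exp (-q * #W * (#B - γ))` if every vertex has at most `γ` non-neighbours. -/
theorem setBernoulli_real_no_edge_le (G : SimpleGraph V) (q : unitInterval) {γ : ℝ}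
    (hγ : ∀ w, ({z | ¬ G.Adj w z}.ncard : ℝ) ≤ γ) {W B : Finset V} (hWB : Disjoint W B) :
    (setBernoulli G.edgeSet q).real {A | ∀ w ∈ W, ∀ b ∈ B, s(w, b) ∉ A} ≤
      Real.exp (-(q * (W.card * (B.card - γ)))) := by
  classical
  -- the edges of `G` between `W` and `B`; disjointness makes the pairs distinct as edges
  set F : Finset (Sym2 V) := ((W ×ˢ B).filter fun x => G.Adj x.1 x.2).image fun x => s(x.1, x.2)
    with hF
  have hFu : (F : Set (Sym2 V)) ⊆ G.edgeSet := by
    intro e he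
    simp only [hF, Finset.coe_image, Set.mem_image, Finset.mem_coe, Finset.mem_filter] at he
    obtain ⟨x, hx, rfl⟩ := he
    exact hx.2
  have hcard : (W.card : ℝ) * (B.card - γ) ≤ F.card := by
    have h1 : F.card = ∑ w ∈ W, (B.filter fun b => G.Adj w b).card := by
      rw [hF, Finset.card_image_of_injOn, Finset.card_filter, Finset.sum_product]
      · simp only [Finset.card_filter]
      · rintro ⟨a, b⟩ hab ⟨c, d⟩ hcd h
        simp only [Finset.coe_filter, Finset.mem_product, Set.mem_ofPred_eq] at hab hcd
        simp only [Sym2.eq_iff] at h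
        rcases h with ⟨rfl, rfl⟩ | ⟨rfl, rfl⟩
        · rfl
        · exact absurd hcd.1.2 (Finset.disjoint_left.1 hWB hab.1.1)
    rw [h1, Nat.cast_sum, ← nsmul_eq_mul, ← Finset.sum_const]
    refine Finset.sum_le_sum fun w _ => ?_
    have h2 := Finset.card_filter_add_card_filter_not (s := B) (fun b => G.Adj w b)
    have h3 : (B.filter fun b => ¬ G.Adj w b).card ≤ {z | ¬ G.Adj w z}.ncard := by
      rw [← Set.ncard_coe_finset]
      exact Set.ncard_le_ncard (by intro z; simp) (Set.toFinite _)
    have h4 := hγ w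
    have h5 : ((B.filter fun b => ¬ G.Adj w b).card : ℝ) ≤ {z | ¬ G.Adj w z}.ncard := by
      exact_mod_cast h3
    have h6 : ((B.filter fun b => G.Adj w b).card : ℝ) +
      (B.filter fun b => ¬ G.Adj w b).card = B.card := by exact_mod_cast h2
    linarith
  calc (setBernoulli G.edgeSet q).real {A | ∀ w ∈ W, ∀ b ∈ B, s(w, b) ∉ A}
      ≤ (setBernoulli G.edgeSet q).real {A | ∀ i ∈ F, i ∉ A} := by
        refine measureReal_mono ?_
        intro A hA i hi
        simp only [hF, Finset.mem_image, Finset.mem_filter, Finset.mem_product] at hi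
        obtain ⟨x, hx, rfl⟩ := hi
        exact hA _ hx.1.1 _ hx.1.2
    _ = (1 - (q : ℝ)) ^ F.card := setBernoulli_real_disjoint _ _ _ hFu
    _ ≤ Real.exp (-q) ^ F.card :=
        pow_le_pow_left₀ (by linarith [q.2.2]) (Real.one_sub_le_exp_neg _) _
    _ = Real.exp (-(q * F.card)) := by rw [← Real.exp_nat_mul]; ring_nf
    _ ≤ _ := by
        refine Real.exp_le_exp.2 (neg_le_neg ?_)
        exact mul_le_mul_of_nonneg_left hcard q.2.1

/-- The edge set `A` fails to expand from `P` into `Q`: some nonempty `W ⊆ P` has all its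
`A`-neighbours in `Q` inside a set `C` of size at most `k * #W` that misses at least `r` vertices
of `Q`. -/
def NonExpanding (P Q : Finset V) (k : ℕ) (r : ℝ) (A : Set (Sym2 V)) : Prop :=
  ∃ W ⊆ P, W.Nonempty ∧ ∃ C ⊆ Q, C.card ≤ k * W.card ∧ r ≤ (Q.card : ℝ) - C.card ∧
    ∀ w ∈ W, ∀ b ∈ Q, s(w, b) ∈ A → b ∈ C

theorem sum_powerset_pow_le {α : Type*} (P : Finset α) {n : ℕ} (hP : P.card ≤ n) {t : ℝ}
    (ht : 0 ≤ t) : ∑ W ∈ P.powerset, t ^ W.card ≤ Real.exp (n * t) := by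
  have h := Finset.sum_pow_mul_eq_add_pow t 1 P
  simp only [one_pow, mul_one] at h
  rw [h, Real.exp_nat_mul]
  calc (t + 1) ^ P.card ≤ Real.exp t ^ P.card :=
        pow_le_pow_left₀ (by linarith) (Real.add_one_le_exp t) _
    _ ≤ Real.exp t ^ n := pow_le_pow_right₀ (Real.one_le_exp ht) hP

/-- The union bound over `W` and `C` in `NonExpanding`: a given `W` has at most `n ^ (k * #W)`
choices for `C`, up to a constant factor, which the probability `n ^ (-(k + 11) * #W)` of seeing
no edge beats. -/
theorem setBernoulli_real_nonExpanding_le (G : SimpleGraph V) (q : unitInterval) {γ : ℝ}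
    (hγ : ∀ w, ({z | ¬ G.Adj w z}.ncard : ℝ) ≤ γ) {P Q : Finset V} (hPQ : Disjoint P Q)
    {n : ℕ} (hn : 1 ≤ n) (hV : Fintype.card V = n) {k : ℕ} {r : ℝ}
    (h : (k + 11) * Real.log n ≤ q * (r - γ)) :
    (setBernoulli G.edgeSet q).real {A | NonExpanding P Q k r A} ≤ 6 / (n : ℝ) ^ 10 := by
  classical
  set μ := setBernoulli G.edgeSet q
  have hn0 : (0 : ℝ) < n := by exact_mod_cast hn
  have hn1 : (1 : ℝ) ≤ n := by exact_mod_cast hn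
  set I := P.powerset.erase ∅ ×ˢ Q.powerset with hI
  set S : Finset V × Finset V → Set (Set (Sym2 V)) := fun x =>
    {A | x.2.card ≤ k * x.1.card ∧ r ≤ (Q.card : ℝ) - x.2.card ∧
      ∀ w ∈ x.1, ∀ b ∈ Q, s(w, b) ∈ A → b ∈ x.2} with hS
  have hsub : {A | NonExpanding P Q k r A} ⊆ ⋃ x ∈ I, S x := by
    rintro A ⟨W, hW, hW0, C, hC, h1, h2, h3⟩
    refine Set.mem_biUnion (x := (W, C)) ?_ ⟨h1, h2, h3⟩
    simp [hI, hW, hC, hW0.ne_empty]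
  have hSx : ∀ x ∈ I, μ.real (S x) ≤ ((n : ℝ)⁻¹ ^ 11) ^ x.1.card * (n : ℝ)⁻¹ ^ x.2.card := by
    rintro ⟨W, C⟩ hx
    simp only [hI, Finset.mem_product, Finset.mem_erase, Finset.mem_powerset] at hx
    obtain ⟨⟨hW0, hW⟩, hC⟩ := hx
    by_cases hc : C.card ≤ k * W.card ∧ r ≤ (Q.card : ℝ) - C.card
    · have hd : Disjoint W (Q \ C) := (hPQ.mono_left hW).mono_right Finset.sdiff_subset
      calc μ.real (S (W, C)) ≤ μ.real {A | ∀ w ∈ W, ∀ b ∈ Q \ C, s(w, b) ∉ A} := by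
            refine measureReal_mono ?_
            intro A hA w hw b hb hwb
            rw [Finset.mem_sdiff] at hb
            exact hb.2 (hA.2.2 w hw b hb.1 hwb)
        _ ≤ _ := setBernoulli_real_no_edge_le G q hγ hd
        _ ≤ Real.exp (-(((k + 11) * W.card : ℕ) * Real.log n)) := by
            refine Real.exp_le_exp.2 (neg_le_neg ?_)
            have h1 : ((Q \ C).card : ℝ) = Q.card - C.card := by
              rw [Finset.card_sdiff_of_subset hC, Nat.cast_sub (Finset.card_le_card hC)]
            have h2 : (q : ℝ) * (r - γ) ≤ q * (((Q \ C).card : ℝ) - γ) :=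
              mul_le_mul_of_nonneg_left (by rw [h1]; linarith [hc.2]) q.2.1
            have h3 : (0 : ℝ) ≤ W.card := Nat.cast_nonneg _
            push_cast
            nlinarith [mul_le_mul_of_nonneg_left (h.trans h2) h3]
        _ = (n : ℝ)⁻¹ ^ ((k + 11) * W.card) := by
            rw [← mul_neg, Real.exp_nat_mul, Real.exp_neg, Real.exp_log hn0]
        _ = ((n : ℝ)⁻¹ ^ 11) ^ W.card * (n : ℝ)⁻¹ ^ (k * W.card) := by
            rw [← pow_mul, ← pow_add]; ring_nf
        _ ≤ _ := by
            refine mul_le_mul_of_nonneg_left ?_ (by positivity)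
            exact pow_le_pow_of_le_one (by positivity) (inv_le_one_of_one_le₀ hn1) hc.1
    · have : S (W, C) = ∅ := by
        ext A
        simp only [hS, Set.mem_ofPred_eq, Set.mem_empty_iff_false, iff_false]
        exact fun hA => hc ⟨hA.1, hA.2.1⟩
      rw [this, measureReal_empty]
      positivity
  have hcP : ∀ X : Finset V, X.card ≤ n := fun X => hV ▸ X.card_le_univ
  have hQ : ∑ C ∈ Q.powerset, (n : ℝ)⁻¹ ^ C.card ≤ 3 := by
    refine (sum_powerset_pow_le Q (hcP Q) (by positivity)).trans ?_
    rw [mul_inv_cancel₀ hn0.ne']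
    linarith [Real.exp_one_lt_d9]
  have hP : ∑ W ∈ P.powerset.erase ∅, ((n : ℝ)⁻¹ ^ 11) ^ W.card ≤ 2 / (n : ℝ) ^ 10 := by
    have h1 := sum_powerset_pow_le P (hcP P) (t := (n : ℝ)⁻¹ ^ 11) (by positivity)
    rw [← Finset.add_sum_erase _ _ (Finset.empty_mem_powerset P)] at h1
    -- removing `W = ∅` leaves `exp (n ^ (-10)) - 1`, which is of order `n ^ (-10)`
    have h2 : (n : ℝ) * (n : ℝ)⁻¹ ^ 11 = 1 / (n : ℝ) ^ 10 := by field_simp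
    rw [h2, Finset.card_empty, pow_zero] at h1
    have h3 : 0 ≤ 1 / (n : ℝ) ^ 10 := by positivity
    have h4 : 1 / (n : ℝ) ^ 10 ≤ 1 := by
      rw [div_le_one (by positivity)]; exact one_le_pow₀ hn1
    have h5 := Real.abs_exp_sub_one_le (x := 1 / (n : ℝ) ^ 10) (by rwa [abs_of_nonneg h3])
    rw [abs_of_nonneg h3] at h5
    have h6 := (le_abs_self _).trans h5
    have h7 : 2 / (n : ℝ) ^ 10 = 2 * (1 / (n : ℝ) ^ 10) := by ring
    linarith
  calc μ.real {A | NonExpanding P Q k r A} ≤ μ.real (⋃ x ∈ I, S x) :=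
        measureReal_mono hsub (measure_ne_top _ _)
    _ ≤ ∑ x ∈ I, μ.real (S x) := measureReal_biUnion_finset_le _ _
    _ ≤ ∑ x ∈ I, ((n : ℝ)⁻¹ ^ 11) ^ x.1.card * (n : ℝ)⁻¹ ^ x.2.card := Finset.sum_le_sum hSx
    _ = (∑ W ∈ P.powerset.erase ∅, ((n : ℝ)⁻¹ ^ 11) ^ W.card) *
          ∑ C ∈ Q.powerset, (n : ℝ)⁻¹ ^ C.card := by
        rw [hI, Finset.sum_product, Finset.sum_mul_sum]
    _ ≤ 2 / (n : ℝ) ^ 10 * 3 := mul_le_mul hP hQ (by positivity) (by positivity)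
    _ = _ := by ring

end SimpleGraph

/-! ### Greedy embedding of the non-leaves -/

namespace SimpleGraph

/-- A rooted tree, encoded by its parent function `par`, with a set `leaves` of non-root vertices
that are parents of no vertex. The rank decreases towards the root; the value of `par` at the root
carries no information. -/
structure LeafyTree (U : Type*) [Fintype U] where
  root : U
  par : U → U
  rank : U → ℕ
  leaves : Finset U
  rank_par_lt : ∀ u, u ≠ root → rank (par u) < rank u
  root_notMem : root ∉ leaves
  par_notMem : ∀ u, u ≠ root → par u ∉ leaves

namespace LeafyTree

variable {U : Type*} [Fintype U] (t : LeafyTree U)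

open Classical in
/-- The non-root vertices with parent `w`. -/
noncomputable def children (w : U) : Finset U := {u | u ≠ t.root ∧ t.par u = w}

open Classical in
/-- The non-leaves that are embedded once the children of every vertex in `X` are. -/
noncomputable def placed (X : Finset U) : Finset U :=
  {u | u ∉ t.leaves ∧ (u = t.root ∨ t.par u ∈ X)}

theorem mem_children {u w : U} : u ∈ t.children w ↔ u ≠ t.root ∧ t.par u = w := by
  simp [children]

theorem mem_placed {u : U} {X : Finset U} :
    u ∈ t.placed X ↔ u ∉ t.leaves ∧ (u = t.root ∨ t.par u ∈ X) := by
  simp [placed]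

/-- As long as some non-leaf is not placed, some placed vertex is still to be expanded. -/
theorem exists_mem_placed_notMem {X : Finset U} (h : ∃ u, u ∉ t.leaves ∧ u ∉ t.placed X) :
    ∃ w ∈ t.placed X, w ∉ X := by
  obtain ⟨u, ⟨hu, huX⟩, hmin⟩ := WellFounded.has_min (measure t.rank).wf
    {u | u ∉ t.leaves ∧ u ∉ t.placed X} h
  have hr : u ≠ t.root := by
    rintro rfl
    exact huX (t.mem_placed.2 ⟨hu, Or.inl rfl⟩)
  refine ⟨t.par u, ?_, fun hX => huX (t.mem_placed.2 ⟨hu, Or.inr hX⟩)⟩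
  by_contra hp
  exact hmin _ ⟨t.par_notMem u hr, hp⟩ (t.rank_par_lt u hr)

/-- The embedding `φ` of the placed vertices extends to the non-leaves, the new edges being
in `A`. -/
def Extends {V : Type*} (X : Finset U) (φ : U → V) (A : Set (Sym2 V)) : Prop :=
  ∃ ψ : U → V, Set.EqOn ψ φ (t.placed X) ∧ Set.InjOn ψ {u | u ∉ t.leaves} ∧
    ∀ u, u ∉ t.leaves → u ∉ t.placed X → s(ψ u, ψ (t.par u)) ∈ A

variable {V : Type*}

/-- The deterministic step of the greedy embedding: enough `A₁`-neighbours `N` of `φ w` outside the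
image of `φ` make room for the children of `w`, and the rest of the embedding uses only edges that
avoid `φ w`. -/
theorem exists_extension_of_card_le [DecidableEq U] {X : Finset U} {φ : U → V}
    (hφ : Set.InjOn φ (t.placed X)) {w : U} (hw : w ∈ t.placed X) (hwX : w ∉ X) {N : Finset V}
    (hN : ∀ z ∈ N, ∀ u ∈ t.placed X, z ≠ φ u) (hcard : (t.children w).card ≤ N.card) :
    ∃ φ' : U → V, Set.InjOn φ' (t.placed (insert w X)) ∧
      ∀ A₁ A₂ : Set (Sym2 V), (∀ z ∈ N, s(φ w, z) ∈ A₁) → t.Extends (insert w X) φ' A₂ →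
        t.Extends X φ ((A₁ ∩ {e | φ w ∈ e}) ∪ (A₂ \ {e | φ w ∈ e})) := by
  classical
  obtain ⟨f, hf, hfN⟩ : ∃ f : U → V, Set.InjOn f (t.children w) ∧ ∀ u ∈ t.children w, f u ∈ N := by
    obtain ⟨e⟩ : Nonempty (t.children w ↪ N) :=
      Function.Embedding.nonempty_of_card_le (by simpa using hcard)
    refine ⟨fun u => if hu : u ∈ t.children w then e ⟨u, hu⟩ else φ u, ?_, fun u hu => ?_⟩
    · intro a ha b hb hab
      simp only [Finset.mem_coe] at ha hb
      simp only [ha, hb, dif_pos] at hab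
      simpa using e.injective (Subtype.ext hab)
    · simp [hu]
  have hmem : ∀ u, u ∈ t.placed (insert w X) ↔
      u ∈ t.placed X ∨ (u ∈ t.children w ∧ u ∉ t.leaves) := by
    intro u
    simp only [mem_placed, mem_children, Finset.mem_insert]
    tauto
  have hnot : ∀ u ∈ t.placed X, u ∉ t.children w := by
    intro u hu hc
    rw [mem_placed] at hu
    rw [mem_children] at hc
    rcases hu.2 with h | h
    · exact hc.1 h
    · exact hwX (hc.2 ▸ h)
  set φ' : U → V := fun u => if u ∈ t.children w then f u else φ u with hφ'
  have hφ'1 : ∀ u ∈ t.placed X, φ' u = φ u := fun u hu => by simp [hφ', hnot u hu]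
  have hφ'2 : ∀ u ∈ t.children w, φ' u = f u := fun u hu => by simp [hφ', hu]
  refine ⟨φ', ?_, ?_⟩
  · intro a ha b hb hab
    rw [Finset.mem_coe, hmem] at ha hb
    rcases ha with ha | ha <;> rcases hb with hb | hb
    · rw [hφ'1 a ha, hφ'1 b hb] at hab
      exact hφ ha hb hab
    · rw [hφ'1 a ha, hφ'2 b hb.1] at hab
      exact absurd hab.symm (hN _ (hfN b hb.1) a ha)
    · rw [hφ'2 a ha.1, hφ'1 b hb] at hab
      exact absurd hab (hN _ (hfN a ha.1) b hb)
    · rw [hφ'2 a ha.1, hφ'2 b hb.1] at hab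
      exact hf ha.1 hb.1 hab
  · rintro A₁ A₂ hA₁ ⟨ψ, hψ, hinj, hedge⟩
    have hψ1 : ∀ u ∈ t.placed X, ψ u = φ u := fun u hu => by
      rw [hψ ((hmem u).2 (Or.inl hu)), hφ'1 u hu]
    have hwl : w ∉ t.leaves := (t.mem_placed.1 hw).1
    refine ⟨ψ, hψ1, hinj, ?_⟩
    intro u hu huX
    by_cases hc : u ∈ t.children w
    · left
      have h1 : ψ u = f u := by rw [hψ ((hmem u).2 (Or.inr ⟨hc, hu⟩)), hφ'2 u hc]
      rw [(t.mem_children.1 hc).2, h1, hψ1 w hw, Sym2.eq_swap]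
      exact ⟨hA₁ _ (hfN u hc), by simp⟩
    · right
      have hur : u ≠ t.root := by
        rintro rfl
        exact huX (t.mem_placed.2 ⟨hu, Or.inl rfl⟩)
      refine ⟨hedge u hu (fun h => ((hmem u).1 h).elim huX fun h => hc h.1), ?_⟩
      rw [Set.mem_ofPred_eq, ← hψ1 w hw, Sym2.mem_iff]
      rintro (h | h)
      · exact huX (hinj hwl hu h ▸ hw)
      · exact hc (t.mem_children.2 ⟨hur, (hinj hwl (t.par_notMem u hur) h).symm⟩)

theorem extends_of_forall_mem_placed {X : Finset U} {φ : U → V}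
    (h : ∀ u, u ∉ t.leaves → u ∈ t.placed X) (hφ : Set.InjOn φ (t.placed X)) (A : Set (Sym2 V)) :
    t.Extends X φ A :=
  ⟨φ, fun _ _ => rfl, hφ.mono h, fun u hu hu' => absurd (h u hu) hu'⟩

/-- The greedy embedding of the non-leaves, where each of the remaining expansions fails with
probability at most `ε`. -/
theorem setBernoulli_real_not_extends_le [Fintype V] (E : Set (Sym2 V)) (q : unitInterval) {Δ : ℕ}
    (hΔ : ∀ w, (t.children w).card ≤ Δ) (hcard : Fintype.card U ≤ Fintype.card V) {ε : ℝ}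
    (hε : 0 ≤ ε)
    (h : ∀ (y : V) (Z : Finset V), y ∉ Z → t.leaves.card ≤ Z.card →
      (setBernoulli E q).real {A | {z | z ∈ Z ∧ s(y, z) ∈ A}.ncard < Δ} ≤ ε) (m : ℕ) :
    ∀ (X : Finset U) (φ : U → V), {u | u ∉ t.leaves ∧ u ∉ X}.ncard ≤ m → X ⊆ t.placed X →
      Set.InjOn φ (t.placed X) →
      (setBernoulli E q).real {A | ¬ t.Extends X φ A} ≤ m * ε := by
  classical
  induction m with
  | zero =>
    intro X φ hm hX hφ
    have h1 : ∀ u, u ∉ t.leaves → u ∈ t.placed X := by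
      intro u hu
      by_contra hu'
      have h2 := (Set.ncard_eq_zero (Set.toFinite _)).1 (Nat.le_zero.1 hm)
      exact (h2 ▸ (⟨hu, fun h => hu' (hX h)⟩ : u ∈ {u | u ∉ t.leaves ∧ u ∉ X}) : u ∈ (∅ : Set U))
    have h0 : {A | ¬ t.Extends X φ A} = ∅ := by
      ext A
      simp [t.extends_of_forall_mem_placed h1 hφ A]
    simp [h0]
  | succ m ih =>
    intro X φ hm hX hφ
    by_cases hex : ∃ u, u ∉ t.leaves ∧ u ∉ t.placed X
    swap
    · have h0 : {A | ¬ t.Extends X φ A} = ∅ := by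
        push Not at hex
        ext A
        simp [t.extends_of_forall_mem_placed hex hφ A]
      rw [h0, measureReal_empty]
      positivity
    obtain ⟨w, hw, hwX⟩ := t.exists_mem_placed_notMem hex
    -- the unused vertices, at least as many as there are leaves
    set Z : Finset V := Finset.univ \ (t.placed X).image φ with hZ
    set N : Set (Sym2 V) → Finset V := fun A => {z ∈ Z | s(φ w, z) ∈ A} with hN
    have hstep : ∀ A, (t.children w).card ≤ (N A).card → ∃ φ' : U → V,
        Set.InjOn φ' (t.placed (insert w X)) ∧
        ∀ A₂ : Set (Sym2 V), t.Extends (insert w X) φ' A₂ →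
          t.Extends X φ ((A ∩ {e | φ w ∈ e}) ∪ (A₂ \ {e | φ w ∈ e})) := by
      intro A hA
      obtain ⟨φ', h1, h2⟩ := t.exists_extension_of_card_le hφ hw hwX (N := N A) (by
        intro z hz u hu hzu
        simp only [hN, hZ, Finset.mem_filter, Finset.mem_sdiff] at hz
        exact hz.1.2 (hzu ▸ Finset.mem_image_of_mem φ hu)) hA
      exact ⟨φ', h1, fun A₂ => h2 A A₂ (fun z hz => (Finset.mem_filter.1 hz).2)⟩
    have : Nonempty V := ⟨φ w⟩
    choose! φ' hφ' hext using hstep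
    have hb := setBernoulli_real_le_of_reveal E {e | φ w ∈ e} q {A | ¬ t.Extends X φ A}
      {A | {z | z ∈ Z ∧ s(φ w, z) ∈ A}.ncard < Δ}
      (fun A => {A₂ | (t.children w).card ≤ (N A).card ∧ ¬ t.Extends (insert w X) (φ' A) A₂})
      (ε₁ := ε) (ε₂ := m * ε) ?_ (h _ _ ?_ ?_) (by positivity) ?_
    · push_cast
      linarith
    · intro A₁ A₂ hA
      by_contra hcon
      simp only [not_or, Set.mem_ofPred_eq, not_lt, not_and, not_not] at hcon hA
      have h1 : (t.children w).card ≤ (N A₁).card := by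
        refine (hΔ w).trans (hcon.1.trans_eq ?_)
        rw [← Set.ncard_coe_finset]
        congr 1
        ext z
        simp [hN]
      exact hA (hext A₁ h1 A₂ (hcon.2 h1))
    · simp only [hZ, Finset.mem_sdiff, not_and, not_not]
      exact fun _ => Finset.mem_image_of_mem φ hw
    · have h1 : ((t.placed X).image φ).card ≤ Fintype.card U - t.leaves.card := by
        rw [← Finset.card_compl]
        refine Finset.card_image_le.trans (Finset.card_le_card fun u hu => ?_)
        exact Finset.mem_compl.2 (t.mem_placed.1 hu).1
      have h2 := t.leaves.card_le_univ
      rw [hZ, Finset.card_sdiff_of_subset (Finset.subset_univ _), Finset.card_univ]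
      omega
    · intro A
      by_cases hA : (t.children w).card ≤ (N A).card
      · simp only [hA, true_and]
        refine ih (insert w X) (φ' A) ?_ ?_ (hφ' A hA)
        · have h1 : {u | u ∉ t.leaves ∧ u ∉ insert w X} ⊂ {u | u ∉ t.leaves ∧ u ∉ X} := by
            refine ⟨fun u hu => ⟨hu.1, fun h => hu.2 (Finset.mem_insert_of_mem h)⟩, fun hsub => ?_⟩
            exact (hsub ⟨(t.mem_placed.1 hw).1, hwX⟩).2 (Finset.mem_insert_self _ _)
          have h2 := Set.ncard_lt_ncard h1 (Set.toFinite _)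
          omega
        · have h1 : t.placed X ⊆ t.placed (insert w X) := by
            intro u hu
            rw [mem_placed] at hu ⊢
            exact ⟨hu.1, hu.2.imp_right Finset.mem_insert_of_mem⟩
          exact Finset.insert_subset (h1 hw) (hX.trans h1)
      · simp only [hA, false_and]
        have h0 : {A₂ : Set (Sym2 V) | False} = ∅ := rfl
        rw [h0, measureReal_empty]
        positivity

end LeafyTree

end SimpleGraph

/-! ### Attaching the leaves -/

namespace SimpleGraph

namespace LeafyTree

variable {U V : Type*} [Fintype U] (t : LeafyTree U)

/-- Hall's theorem for attaching the leaves. A violator `S` with at most half of the leaves makes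
the parents of `S` expand badly into the unused vertices `L`; for a larger `S` there are still
unused vertices not adjacent to the parents of `S`, and these expand badly into the set `M` of all
parents, because few parents have all their leaves outside `S`. -/
theorem exists_leaf_matching [DecidableEq V] {Δ : ℕ} (hΔ0 : 0 < Δ)
    (hΔ : ∀ w, (t.children w).card ≤ Δ) {φ : U → V} (hφ : Set.InjOn φ {u | u ∉ t.leaves})
    {L M : Finset V} (hM : M = t.leaves.image fun u => φ (t.par u)) (hL : L.card = t.leaves.card)
    {A : Set (Sym2 V)} (h₁ : ¬ NonExpanding M L Δ ((t.leaves.card : ℝ) / 2) A)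
    (h₂ : ¬ NonExpanding L M 1 ((t.leaves.card : ℝ) / (2 * Δ)) A) :
    ∃ f : U → V, Set.InjOn f t.leaves ∧ ∀ u ∈ t.leaves, f u ∈ L ∧ s(f u, φ (t.par u)) ∈ A := by
  classical
  have hroot : ∀ u ∈ t.leaves, u ≠ t.root := by
    rintro u hu rfl
    exact t.root_notMem hu
  set g : U → V := fun u => φ (t.par u) with hg
  have hdeg : ∀ S ⊆ t.leaves, S.card ≤ Δ * (S.image g).card := by
    intro S hS
    refine Finset.card_le_mul_card_image S Δ fun b hb => ?_
    obtain ⟨w, hw, rfl⟩ := Finset.mem_image.1 hb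
    refine (Finset.card_le_card fun u hu => ?_).trans (hΔ (t.par w))
    obtain ⟨hu, huw⟩ := Finset.mem_filter.1 hu
    exact t.mem_children.2 ⟨hroot u (hS hu),
      hφ (t.par_notMem u (hroot u (hS hu))) (t.par_notMem w (hroot w (hS hw))) huw⟩
  have hall : ∀ s : Finset t.leaves,
      s.card ≤ (s.biUnion fun u => L.filter fun z => s(z, g u) ∈ A).card := by
    intro s
    by_contra hlt
    rw [not_le] at hlt
    set C := s.biUnion fun u => L.filter fun z => s(z, g u) ∈ A with hC
    set S : Finset U := s.map ⟨Subtype.val, Subtype.val_injective⟩ with hS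
    have hSs : S.card = s.card := Finset.card_map _
    have hSl : S ⊆ t.leaves := by
      intro u hu
      obtain ⟨w, _, rfl⟩ := Finset.mem_map.1 hu
      exact w.2
    have hSl' := Finset.card_le_card hSl
    have hCL : C ⊆ L := Finset.biUnion_subset.2 fun u _ => Finset.filter_subset _ _
    have hmemC : ∀ w ∈ S.image g, ∀ b ∈ L, s(b, w) ∈ A → b ∈ C := by
      intro w hw b hb hwb
      obtain ⟨u, hu, rfl⟩ := Finset.mem_image.1 hw
      obtain ⟨u', hu', rfl⟩ := Finset.mem_map.1 hu
      exact Finset.mem_biUnion.2 ⟨u', hu', Finset.mem_filter.2 ⟨hb, hwb⟩⟩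
    have hSne : S.Nonempty := Finset.card_pos.1 (by omega)
    have hdegS := hdeg S hSl
    by_cases hhalf : (S.card : ℝ) ≤ t.leaves.card / 2
    · refine h₁ ⟨S.image g, hM ▸ Finset.image_subset_image hSl, hSne.image g, C, hCL, by omega, ?_,
        fun w hw b hb hwb => hmemC w hw b hb (Sym2.eq_swap ▸ hwb)⟩
      have h3 : (C.card : ℝ) ≤ S.card := by exact_mod_cast (by omega : C.card ≤ S.card)
      rw [hL]
      linarith
    · have hBcard : (L \ C).card = t.leaves.card - C.card := by
        rw [Finset.card_sdiff_of_subset hCL, hL]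
      have hMS : S.image g ⊆ M := hM ▸ Finset.image_subset_image hSl
      refine h₂ ⟨L \ C, Finset.sdiff_subset, Finset.card_pos.1 (by omega), M \ S.image g,
        Finset.sdiff_subset, ?_, ?_, ?_⟩
      · have h3 : M \ S.image g ⊆ (t.leaves \ S).image g := by
          intro w hw
          rw [Finset.mem_sdiff, hM] at hw
          obtain ⟨u, hu, rfl⟩ := Finset.mem_image.1 hw.1
          exact Finset.mem_image_of_mem g
            (Finset.mem_sdiff.2 ⟨hu, fun h => hw.2 (Finset.mem_image_of_mem g h)⟩)
        have h4 := (Finset.card_le_card h3).trans Finset.card_image_le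
        rw [Finset.card_sdiff_of_subset hSl] at h4
        omega
      · have h3 : ((M \ S.image g).card : ℝ) + (S.image g).card = M.card := by
          exact_mod_cast Finset.card_sdiff_add_card_eq_card hMS
        have h4 : (S.card : ℝ) ≤ Δ * (S.image g).card := by exact_mod_cast hdegS
        have h5 : (0 : ℝ) < Δ := by exact_mod_cast hΔ0
        rw [div_le_iff₀ (by positivity)]
        have h6 : (M.card : ℝ) - (M \ S.image g).card = (S.image g).card := by linarith
        rw [h6]
        linarith
      · intro b hb w hw hbw
        rw [Finset.mem_sdiff] at hb ⊢
        exact ⟨hw, fun h => hb.2 (hmemC w h b hb.1 hbw)⟩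
  obtain ⟨f, hf, hfL⟩ := (Finset.all_card_le_biUnion_card_iff_exists_injective _).1 hall
  refine ⟨fun u => if hu : u ∈ t.leaves then f ⟨u, hu⟩ else φ u, ?_, fun u hu => ?_⟩
  · intro a ha b hb hab
    rw [Finset.mem_coe] at ha hb
    simp only [ha, hb, dif_pos] at hab
    simpa using hf hab
  · simpa [hu] using hfL ⟨u, hu⟩

/-- The spanning embedding of a tree with many leaves. The random graph is the union of two
independent ones, the first of which receives the non-leaves and the second the leaves. -/
theorem setBernoulli_real_not_embeds_le [Fintype V] (G : SimpleGraph V) {p q : unitInterval}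
    (hqp : (1 - (q : ℝ)) ^ 2 = 1 - p) {γ : ℝ}
    (hγ : ∀ w, ({z | ¬ G.Adj w z}.ncard : ℝ) ≤ γ) {n : ℕ} (hn : 1 ≤ n)
    (hU : Fintype.card U = n) (hV : Fintype.card V = n) {Δ : ℕ} (hΔ0 : 0 < Δ)
    (hΔ : ∀ w, (t.children w).card ≤ Δ) (x : V)
    (h₁ : (Δ + 11) * Real.log n ≤ q * (t.leaves.card - Δ - γ))
    (h₂ : (Δ + 11) * Real.log n ≤ q * ((t.leaves.card : ℝ) / 2 - γ))
    (h₃ : (1 + 11) * Real.log n ≤ q * ((t.leaves.card : ℝ) / (2 * Δ) - γ)) :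
    (setBernoulli G.edgeSet p).real {A | ¬ ∃ ψ : U → V, Function.Injective ψ ∧ ψ t.root = x ∧
      ∀ u, u ≠ t.root → s(ψ u, ψ (t.par u)) ∈ A} ≤ 18 / (n : ℝ) ^ 9 := by
  classical
  set ε : ℝ := 6 / (n : ℝ) ^ 10 with hε
  have hε0 : 0 ≤ ε := by positivity
  have hn1 : (1 : ℝ) ≤ n := by exact_mod_cast hn
  have hplaced : ∀ u, u ∈ t.placed ∅ ↔ u = t.root := by
    intro u
    simp only [mem_placed, Finset.notMem_empty, or_false, and_iff_right_iff_imp]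
    rintro rfl
    exact t.root_notMem
  have hgreedy : (setBernoulli G.edgeSet q).real {A | ¬ t.Extends ∅ (fun _ => x) A} ≤ n * ε := by
    refine t.setBernoulli_real_not_extends_le G.edgeSet q hΔ (hU.trans hV.symm).le hε0 ?_ n ∅ _ ?_
      (Finset.empty_subset _) ?_
    · intro y Z hy hZ
      refine le_trans (measureReal_mono ?_) (setBernoulli_real_nonExpanding_le G q hγ
        (Finset.disjoint_singleton_left.2 hy) hn hV h₁)
      intro A hA
      set C := Z.filter fun z => s(y, z) ∈ A with hC
      have hCA : C.card < Δ := by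
        rw [← Set.ncard_coe_finset]
        simpa [hC] using hA
      refine ⟨{y}, subset_rfl, Finset.singleton_nonempty y, C, Finset.filter_subset _ _,
        by simpa using hCA.le, ?_, ?_⟩
      · have h4 : (C.card : ℝ) ≤ Δ := by exact_mod_cast hCA.le
        have h5 : (t.leaves.card : ℝ) ≤ Z.card := by exact_mod_cast hZ
        linarith
      · intro w hw b hb hwb
        rw [Finset.mem_singleton] at hw
        exact Finset.mem_filter.2 ⟨hb, hw ▸ hwb⟩
    · exact (Set.ncard_le_card _).trans (by rw [Nat.card_eq_fintype_card, hU])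
    · intro a ha b hb _
      rw [Finset.mem_coe, hplaced] at ha hb
      rw [ha, hb]
  have hchoose : ∀ A, t.Extends ∅ (fun _ => x) A → ∃ φ : U → V, φ t.root = x ∧
      Set.InjOn φ {u | u ∉ t.leaves} ∧
      ∀ u, u ∉ t.leaves → u ≠ t.root → s(φ u, φ (t.par u)) ∈ A := by
    rintro A ⟨φ, h4, h5, h6⟩
    exact ⟨φ, h4 ((hplaced _).2 rfl), h5, fun u hu hur => h6 u hu fun h => hur ((hplaced u).1 h)⟩
  have : Nonempty V := ⟨x⟩
  choose! φ hφx hφinj hφA using hchoose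
  set L : Set (Sym2 V) → Finset V := fun A => Finset.univ \ (t.leavesᶜ).image (φ A) with hL
  set M : Set (Sym2 V) → Finset V := fun A => t.leaves.image fun u => φ A (t.par u) with hM
  have hroot : ∀ u ∈ t.leaves, u ≠ t.root := by
    rintro u hu rfl
    exact t.root_notMem hu
  have hML : ∀ A, Disjoint (M A) (L A) := by
    intro A
    rw [Finset.disjoint_left]
    intro z hz hz'
    obtain ⟨u, hu, rfl⟩ := Finset.mem_image.1 hz
    exact (Finset.mem_sdiff.1 hz').2 (Finset.mem_image_of_mem _
      (Finset.mem_compl.2 (t.par_notMem u (hroot u hu))))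
  refine (setBernoulli_real_le_of_union G.edgeSet q p hqp _ {A | ¬ t.Extends ∅ (fun _ => x) A}
    (fun A => {B | NonExpanding (M A) (L A) Δ ((t.leaves.card : ℝ) / 2) B} ∪
      {B | NonExpanding (L A) (M A) 1 ((t.leaves.card : ℝ) / (2 * Δ)) B})
    ?_ hgreedy (add_nonneg hε0 hε0) ?_).trans ?_
  · intro A B hAB
    by_contra hcon
    simp only [not_or, Set.mem_ofPred_eq, not_not, Set.mem_union] at hcon
    obtain ⟨hA, hB₁, hB₂⟩ := hcon
    have hLcard : (L A).card = t.leaves.card := by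
      have h4 : ((t.leavesᶜ).image (φ A)).card = Fintype.card U - t.leaves.card := by
        rw [Finset.card_image_of_injOn, Finset.card_compl]
        refine (hφinj A hA).mono fun u hu => ?_
        simpa using hu
      have h5 := t.leaves.card_le_univ
      rw [hL, Finset.card_sdiff_of_subset (Finset.subset_univ _), Finset.card_univ]
      omega
    obtain ⟨f, hf, hfL⟩ := t.exists_leaf_matching hΔ0 hΔ (hφinj A hA) rfl hLcard hB₁ hB₂
    have hdisj : ∀ a ∈ t.leaves, ∀ b, b ∉ t.leaves → f a ≠ φ A b := by
      intro a ha b hb hab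
      exact (Finset.mem_sdiff.1 (hfL a ha).1).2
        (hab ▸ Finset.mem_image_of_mem _ (Finset.mem_compl.2 hb))
    refine hAB ⟨fun u => if u ∈ t.leaves then f u else φ A u, ?_, ?_, ?_⟩
    · intro a b hab
      by_cases ha : a ∈ t.leaves <;> by_cases hb : b ∈ t.leaves <;>
        simp only [ha, hb, if_true, if_false] at hab
      · exact hf ha hb hab
      · exact absurd hab (hdisj a ha b hb)
      · exact absurd hab.symm (hdisj b hb a ha)
      · exact hφinj A hA ha hb hab
    · simp only [t.root_notMem, if_false]
      exact hφx A hA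
    · intro u hu
      simp only [t.par_notMem u hu, if_false]
      by_cases hul : u ∈ t.leaves
      · simp only [hul, if_true]
        exact Or.inr (hfL u hul).2
      · simp only [hul, if_false]
        exact Or.inl (hφA A hA u hul hu)
  · intro A
    refine (measureReal_union_le _ _).trans (add_le_add ?_ ?_)
    · exact setBernoulli_real_nonExpanding_le G q hγ (hML A) hn hV h₂
    · exact setBernoulli_real_nonExpanding_le G q hγ (hML A).symm hn hV (by exact_mod_cast h₃)
  · have h4 : ε ≤ n * ε := le_mul_of_one_le_left hε0 hn1
    have h5 : (n : ℝ) * ε = 6 / (n : ℝ) ^ 9 := by rw [hε]; field_simp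
    have h6 : (18 : ℝ) / (n : ℝ) ^ 9 = 3 * (6 / (n : ℝ) ^ 9) := by ring
    linarith

end LeafyTree

end SimpleGraph

/-! ### Rooting a tree, and the choice of parameters -/

namespace SimpleGraph

/-- A tree as a rooted tree: the parent of `u` is the penultimate vertex of the path from the root
to `u`. -/
theorem IsTree.exists_leafyTree {U : Type*} [Fintype U] {T : SimpleGraph U} [DecidableRel T.Adj]
    (hT : T.IsTree) (v : U) :
    ∃ t : LeafyTree U, t.root = v ∧ (∀ u, u ∈ t.leaves ↔ T.degree u = 1 ∧ u ≠ v) ∧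
      (∀ u, u ≠ v → T.Adj u (t.par u)) ∧
      ∀ u w, T.Adj u w → (u ≠ v ∧ t.par u = w) ∨ (w ≠ v ∧ t.par w = u) := by
  classical
  choose P hP hPu using fun u => hT.existsUnique_path v u
  have hnil : ∀ u, u ≠ v → ¬ (P u).Nil := fun u hu h => hu h.eq.symm
  have hadj : ∀ u, u ≠ v → T.Adj u (P u).penultimate :=
    fun u hu => ((P u).adj_penultimate (hnil u hu)).symm
  have hlen : ∀ u, u ≠ v → (P (P u).penultimate).length < (P u).length := by
    intro u hu
    rw [← hPu _ _ (hP u).dropLast, ← Walk.length_dropLast_add_one (hnil u hu)]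
    exact Nat.lt_succ_self _
  refine ⟨⟨v, fun u => (P u).penultimate, fun u => (P u).length,
    Finset.univ.filter fun u => T.degree u = 1 ∧ u ≠ v, hlen, by simp, ?_⟩, rfl, by simp, hadj, ?_⟩
  · intro u hu hmem
    set w := (P u).penultimate with hw
    obtain ⟨-, hdeg, hwv⟩ := Finset.mem_filter.1 hmem
    obtain ⟨z, hz⟩ := Finset.card_eq_one.1 ((T.card_neighborFinset_eq_degree w).trans hdeg)
    have h1 : u ∈ T.neighborFinset w := by simpa using (hadj u hu).symm
    have h2 : (P w).penultimate ∈ T.neighborFinset w := by simpa using hadj w hwv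
    rw [hz, Finset.mem_singleton] at h1 h2
    have h3 := hlen u hu
    have h4 := hlen w hwv
    rw [h2, ← h1] at h4
    exact lt_asymm h3 h4
  · intro u w huw
    by_cases hw : w ∈ (P u).support
    · refine Or.inl ⟨?_, (hT.isAcyclic.eq_penultimate_of_adj_end (hP u) huw hw).symm⟩
      rintro rfl
      have h1 := hPu u .nil .nil
      rw [← h1] at hw
      exact huw.ne' (by simpa using hw)
    · have h1 := hPu w _ ((hP u).concat hw huw)
      refine Or.inr ⟨?_, ?_⟩
      · rintro rfl
        exact hw (P u).start_mem_support
      · exact (congrArg Walk.penultimate h1).symm.trans (Walk.penultimate_concat _ _)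

end SimpleGraph

/-- The conditions of the three expansion bounds, for `l` leaves, in terms of `L = log n`; each right
hand side is at least `L ^ 2 / 16` times `Δ`, `Δ` and `1`, respectively. -/
theorem expansion_bounds {L Δ γ l q : ℝ} (hL : 300 ≤ L) (hΔ : 1 ≤ Δ) (hγ : 1 ≤ γ)
    (hl : Δ * L ^ 2 * γ / 2 ≤ l) (hq : 1 / 2 ≤ q * γ) :
    (Δ + 11) * L ≤ q * (l - Δ - γ) ∧ (Δ + 11) * L ≤ q * (l / 2 - γ) ∧
      (1 + 11) * L ≤ q * (l / (2 * Δ) - γ) := by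
  have hq0 : 0 ≤ q := by nlinarith
  have hΔγ : 1 ≤ Δ * γ := by nlinarith
  -- here `c = k + 11`, and `d` is the `Δ` or `1` by which `r` is large
  have key : ∀ c d r : ℝ, 1 ≤ d → c ≤ 12 * d → d * (γ * (L ^ 2 / 8)) ≤ r → c * L ≤ q * r := by
    intro c d r hd hc hr
    have h1 : d * (L ^ 2 / 16) ≤ q * (d * (γ * (L ^ 2 / 8))) := by
      have : 0 ≤ (q * γ - 1 / 2) * (d * (L ^ 2 / 8)) :=
        mul_nonneg (by linarith) (by positivity)
      nlinarith
    have h2 : c * L ≤ 12 * d * L := mul_le_mul_of_nonneg_right hc (by linarith)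
    have h3 : 12 * L ≤ L ^ 2 / 16 := by nlinarith
    have h4 := mul_le_mul_of_nonneg_left h3 (by linarith : 0 ≤ d)
    have h5 := mul_le_mul_of_nonneg_left hr hq0
    linarith
  have hL2 : 90000 ≤ L ^ 2 := by nlinarith
  have h1 : Δ ≤ Δ * γ := by nlinarith
  have h2 : γ ≤ Δ * γ := by nlinarith
  have h3 : 90000 * (Δ * γ) ≤ L ^ 2 * (Δ * γ) := mul_le_mul_of_nonneg_right hL2 (by linarith)
  refine ⟨key _ Δ _ hΔ (by linarith) (by nlinarith), key _ Δ _ hΔ (by linarith) (by nlinarith),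
    key _ 1 _ le_rfl (by linarith) ?_⟩
  have h4 : L ^ 2 * γ / 4 ≤ l / (2 * Δ) := by
    rw [le_div_iff₀ (by linarith)]
    nlinarith
  nlinarith

theorem theorem3p1 :
    ∃ n₀ : ℕ, ∀ (n : ℕ), n₀ ≤ n →
      ∀ (U V : Type*) [Fintype U] [Fintype V] (T : SimpleGraph U) (G : SimpleGraph V)
        [DecidableRel T.Adj] [DecidableRel G.Adj] (Δ : ℕ) (v : U) (x : V) (p : unitInterval),
      Fintype.card U = n → Fintype.card V = n →
      T.IsTree → T.maxDegree = Δ →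
      (n : ℝ) / Real.log n ^ 3 ≤ ({u : U | T.degree u = 1}.ncard : ℝ) →
      (n : ℝ) - n / (Δ * Real.log n ^ 5) ≤ (G.minDegree : ℝ) →
      Δ * Real.log n ^ 5 / n ≤ (p : ℝ) →
      1 - 1 / (n : ℝ) ^ 4 ≤ (G.randomSubgraph p).real (T.rootedEmbeddingEvent v x) := by
  have hev : ∀ᶠ n : ℕ in Filter.atTop, 300 ≤ Real.log n ∧ 2 * Real.log n ^ 3 ≤ n ∧ 18 ≤ n := by
    have h1 := (Real.tendsto_log_atTop.comp tendsto_natCast_atTop_atTop).eventually_ge_atTop 300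
    have h2 := ((Real.isLittleO_pow_log_id_atTop (n := 3)).bound
      (by norm_num : (0 : ℝ) < 1 / 2)).natCast_atTop
    filter_upwards [h1, h2, Filter.eventually_ge_atTop 18] with n h1 h2 h3
    refine ⟨h1, ?_, h3⟩
    have h4 : 0 ≤ Real.log n := by
      have : (300 : ℝ) ≤ Real.log n := h1
      linarith
    rw [Real.norm_of_nonneg (by positivity), id, Real.norm_of_nonneg (by positivity)] at h2
    linarith
  obtain ⟨n₀, hn₀⟩ := Filter.eventually_atTop.1 hev
  refine ⟨n₀, fun n hn U V _ _ T G _ _ Δ v x p hU hV hT hΔ hleaf hG hp => ?_⟩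
  classical
  obtain ⟨hL, hLn, hn18⟩ := hn₀ n hn
  set L := Real.log n with hLdef
  have hn0 : (0 : ℝ) < n := by exact_mod_cast (by omega : 0 < n)
  have hL0 : 0 < L := by linarith
  obtain ⟨t, hroot, hleaves, hpar, hadj⟩ := hT.exists_leafyTree v
  have hdeg : ∀ u, T.degree u ≤ Δ := fun u => hΔ ▸ T.degree_le_maxDegree u
  have hΔ0 : 0 < Δ := by
    have : Nontrivial U := Fintype.one_lt_card_iff_nontrivial.1 (by omega)
    obtain ⟨u, hu⟩ := exists_ne v
    exact ((T.degree_pos_iff_exists_adj u).2 ⟨_, hpar u hu⟩).trans_le (hdeg u)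
  have hΔ1 : (1 : ℝ) ≤ Δ := by exact_mod_cast hΔ0
  have hchild : ∀ w, (t.children w).card ≤ Δ := by
    intro w
    refine (Finset.card_le_card fun u hu => ?_).trans (hdeg w)
    obtain ⟨h1, h2⟩ := t.mem_children.1 hu
    simpa [h2] using (hpar u (hroot ▸ h1)).symm
  set γ : ℝ := n / (Δ * L ^ 5) with hγdef
  have hγ0 : 0 < γ := by positivity
  have hpγ : 1 ≤ p * γ := by
    rw [div_le_iff₀ hn0] at hp
    rw [hγdef, ← mul_div_assoc, le_div_iff₀ (by positivity)]
    linarith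
  -- `p ≤ 1` forces `γ ≥ 1`
  have hγ1 : 1 ≤ γ := by nlinarith [p.2.2]
  have hnon : ∀ w, ({z | ¬ G.Adj w z}.ncard : ℝ) ≤ γ := by
    intro w
    have h1 := Set.ncard_add_ncard_compl (G.neighborSet w)
    have h2 : (G.neighborSet w).ncard = G.degree w := by
      rw [← G.card_neighborFinset_eq_degree w, ← Set.ncard_coe_finset, G.coe_neighborFinset]
    have h3 : (G.neighborSet w)ᶜ = {z | ¬ G.Adj w z} := rfl
    rw [h2, h3, Nat.card_eq_fintype_card, hV] at h1
    have h4 : (G.degree w : ℝ) + {z | ¬ G.Adj w z}.ncard = n := by exact_mod_cast h1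
    have h5 : (G.minDegree : ℝ) ≤ G.degree w := by exact_mod_cast G.minDegree_le_degree w
    linarith
  have hl : Δ * L ^ 2 * γ / 2 ≤ t.leaves.card := by
    -- the root `v` may have degree one without being in `t.leaves`
    have h1 : {u : U | T.degree u = 1}.ncard ≤ t.leaves.card + 1 := by
      refine le_trans ?_ (Finset.card_insert_le v t.leaves)
      rw [← Set.ncard_coe_finset]
      refine Set.ncard_le_ncard (fun u hu => ?_) (Set.toFinite _)
      by_cases huv : u = v
      · simp [huv]
      · exact Finset.mem_insert_of_mem ((hleaves u).2 ⟨hu, huv⟩)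
    have h2 : ({u : U | T.degree u = 1}.ncard : ℝ) ≤ t.leaves.card + 1 := by exact_mod_cast h1
    have h3 : Δ * L ^ 2 * γ / 2 = n / L ^ 3 / 2 := by
      rw [hγdef]; field_simp
    have h4 : 2 ≤ n / L ^ 3 := by rwa [le_div_iff₀ (by positivity)]
    linarith
  -- this `q` makes the union of two independent copies of `G_q` distributed as `G_p`
  have hsq : Real.sqrt (1 - p) ^ 2 = 1 - p := Real.sq_sqrt (by linarith [p.2.2])
  have hs0 := Real.sqrt_nonneg (1 - (p : ℝ))
  have hs1 : Real.sqrt (1 - p) ≤ 1 := Real.sqrt_le_one.2 (by linarith [p.2.1])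
  set q : unitInterval := ⟨1 - Real.sqrt (1 - p), by linarith, by linarith⟩ with hq
  have hqp : (1 - (q : ℝ)) ^ 2 = 1 - p := by rw [hq]; simp [hsq]
  have hq2 : (p : ℝ) / 2 ≤ q := by nlinarith [sq_nonneg (q : ℝ)]
  have hqγ : 1 / 2 ≤ q * γ := by nlinarith
  obtain ⟨b1, b2, b3⟩ := expansion_bounds hL hΔ1 hγ1 hl hqγ
  have hbad := t.setBernoulli_real_not_embeds_le G hqp hnon (by omega) hU hV hΔ0 hchild x b1 b2 b3
  have hmeas : MeasurableSet (T.rootedEmbeddingEvent v x : Set (SimpleGraph V)) := by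
    rw [← Set.preimage_image_eq (T.rootedEmbeddingEvent v x)
      (SimpleGraph.edgeSet_injective (V := V))]
    exact SimpleGraph.measurable_edgeSet (.of_discrete)
  rw [SimpleGraph.randomSubgraph, map_measureReal_apply SimpleGraph.measurable_fromEdgeSet hmeas]
  set S := SimpleGraph.fromEdgeSet ⁻¹' (T.rootedEmbeddingEvent v x : Set (SimpleGraph V)) with hS
  have hsub : Sᶜ ⊆ {A | ¬ ∃ ψ : U → V, Function.Injective ψ ∧ ψ t.root = x ∧
      ∀ u, u ≠ t.root → s(ψ u, ψ (t.par u)) ∈ A} := by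
    rintro A hA ⟨ψ, hinj, hx, hedge⟩
    rw [hroot] at hx hedge
    refine hA ⟨⟨⟨ψ, ?_⟩, hinj⟩, hx⟩
    intro u w huw
    rw [SimpleGraph.fromEdgeSet_adj]
    refine ⟨?_, hinj.ne huw.ne⟩
    rcases hadj u w huw with ⟨h1, rfl⟩ | ⟨h1, rfl⟩
    · exact hedge u h1
    · exact Sym2.eq_swap ▸ hedge w h1
  have h1 := (measureReal_mono (μ := setBernoulli G.edgeSet p) hsub).trans hbad
  rw [probReal_compl_eq_one_sub .of_discrete] at h1
  have h2 : 18 / (n : ℝ) ^ 9 ≤ 1 / (n : ℝ) ^ 4 := by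
    rw [div_le_div_iff₀ (by positivity) (by positivity)]
    have h3 : (18 : ℝ) ≤ n := by exact_mod_cast hn18
    have h4 : (n : ℝ) ^ 1 ≤ n ^ 5 := pow_le_pow_right₀ (by linarith) (by norm_num)
    have h5 : (0 : ℝ) < n ^ 4 := by positivity
    nlinarith
  linarith
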